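/- **Conventions.** Fix a field $K$. Digraphs $G=(V(G),E(G))$ are simple (no self-loops), with arbitrary vertex sets; $v\to w$ means $(v,w)\in E(G)$, and $v\,\vec{=}\,w$ means $v=w$ or $v\to w$. A directed $k$-clique is a tuple $v_0\dots v_{k-1}$ of distinct vertices with $v_i\to v_j$ for all $i<j$. $\mathrm{dFl}(G)$ is the ordered simplicial complex of all directed cliques of $G$, and $C_k(G)=\Omega_k(\mathrm{dFl}(G))$ is the $K$-vector space with basis the directed $(k+1)$-cliques, with boundary $\partial(v_0\dots v_k)=\sum_i(-1)^i v_0\dots\hat v_i\dots v_k$. A weighted digraph carries in addition a weighting $w:E(G)\to(0,\infty)$. A path $i\leadsto j$ is a non-empty finite sequence of composable edges from $i$ to $j$; its length is the sum of the weights. For $t\ge 0$, $\mathrm{SP}(G)_t$ is the simple digraph on $V(G)$ with an edge $(i,j)$, $i\ne j$, iff there is a path $i\leadsto j$ in $G$ of length $\le t$. **Grounded persistent directed flag homology.** For $t\in[0,\infty)$ consider the chain complex $$\cdots\to C_3(\mathrm{SP}(G)_t)\to C_2(\mathrm{SP}(G)_t)\to C_1(G\cup\mathrm{SP}(G)_t)\to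 C_0(G\cup\mathrm{SP}(G)_t),$$ with boundary maps $\partial$ (in degree $2$ followed by the inclusion). With the inclusions for $s\le t$ these form a functor from the poset $[0,\infty)$ to chain complexes, and $\mathcal H(G)$ denotes its first homology, a functor from $[0,\infty)$ to $K$-vector spaces. **Interleaving distance.** For $\delta\ge0$ and functors $M,N$ on $[0,\infty)$, a $\delta$-interleaving is a pair of natural transformations $\varphi_t:M(t)\to N(t+\delta)$, $\psi_t:N(t)\to M(t+\delta)$ with $\psi_{t+\delta}\varphi_t=M(t\le t+2\delta)$ and $\varphi_{t+\delta}\psi_t=N(t\le t+2\delta)$ for all $t$; $d_I(M,N)\in[0,\infty]$ is the infimum of all $\delta\ge 0$ for which a $\delta$-interleaving exists. **Homotopies.** A vertex map $f:V(G)\to V(H)$ is a weak digraph map if $v\to w$ implies $f(v)\,\vec{=}\,f(w)$; it is triangle-collapsing if moreover, for every directed $3$-clique $v_0v_1v_2$ of $G$, $f(v_0)=f(v_2)$ implies $f(v_0)=f(v_1)=f(v_2)$. For $A\subseteq V(G)$ and triangle-collapsing maps $f,g:G\to H$ there is a one-step homotopy from $f$ to $g$ relative $A$ if (i) $x\,\vec{=}\,y$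 implies $f(x)\,\vec{=}\,g(y)$; (ii) $x\to y$ and $f(x)=g(y)$ imply $f(x)=f(y)=g(x)=g(y)$; and (iii) $f|_A=g|_A$. Being $\mathrm{dFl}$-homotopic relative $A$ is the equivalence relation on triangle-collapsing maps $G\to H$ generated by one-step homotopies relative $A$. **Grounded interleavings.** Let $G,H$ be weighted digraphs, $\delta\ge 0$, $f:V(G)\to V(H)$, $g:V(H)\to V(G)$. - $f$ is path-collapsing if, whenever $i,j,k$ are distinct vertices of $G$ with paths $i\leadsto j\leadsto k$ and $f(i)=f(k)$, then $f(i)=f(j)=f(k)$. - $f$ is $\delta$-shifting if, for every $t\ge0$, it is a weak digraph map $\mathrm{SP}(G)_t\to\mathrm{SP}(H)_{t+\delta}$ and $G\cup\mathrm{SP}(G)_t\to H\cup\mathrm{SP}(H)_{t+\delta}$. - Let $V_{\mathrm{fix}}(g,f)=\{v\in V(G): g(f(v))=v\}$ and let $G_{\mathrm{diff}}(g,f)$ be the digraph on $V(G)$ whose edges are the $(i,j)\in E(G)$ with $(gf(i),gf(j))\ne(i,j)$. The pair $(g,f)$ has grounded $\mathrm{dFl}$-codistortion $\le\delta$ if $\mathrm{id}$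 and $g\circ f$ are triangle-collapsing digraph maps $G_{\mathrm{diff}}(g,f)\to\mathrm{SP}(G)_{2\delta}$ that are $\mathrm{dFl}$-homotopic relative $V_{\mathrm{fix}}(g,f)$. - $f,g$ form a $\delta$-grounded $\mathrm{dFl}$-interleaving if both are path-collapsing and $\delta$-shifting, and $(g,f)$ and $(f,g)$ both have grounded $\mathrm{dFl}$-codistortion $\le\delta$. **Theorem.** If there is a $\delta$-grounded $\mathrm{dFl}$-interleaving between the weighted digraphs $G$ and $H$, then $$d_I\big(\mathcal H(G),\mathcal H(H)\big)\le\delta .$$ -/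

import Mathlib

open CategoryTheory
open scoped NNReal ENNReal

universe u v

noncomputable section

namespace GroundedFlag

/-! ### Elementary paths and path complexes -/

/-- An elementary `k`-path on `V`: a sequence `v₀ … v_k` of vertices. -/
abbrev ElemPath (V : Type u) (k : ℕ) : Type u := Fin (k + 1) → V

/-- The path `v₀ … v̂ᵢ … v_{k+1}`. -/
def ElemPath.face {V : Type u} {k : ℕ} (p : ElemPath V (k + 1)) (i : Fin (k + 2)) :
    ElemPath V k :=
  fun j => p (i.succAbove j)

/-- A path is regular if no two consecutive vertices coincide. -/
def ElemPath.IsRegular {V : Type u} {k : ℕ} (p : ElemPath V k) : Prop :=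
  ∀ i : Fin k, p i.castSucc ≠ p i.succ

/-- A path complex on `V`: contains all singletons and is closed under truncation at either end. -/
structure PathComplex (V : Type u) where
  paths : ∀ k : ℕ, Set (ElemPath V k)
  singleton_mem : ∀ v : V, (fun _ => v) ∈ paths 0
  tail_mem : ∀ (k : ℕ) (p : ElemPath V (k + 1)), p ∈ paths (k + 1) →
    (fun j : Fin (k + 1) => p j.succ) ∈ paths k
  init_mem : ∀ (k : ℕ) (p : ElemPath V (k + 1)), p ∈ paths (k + 1) →
    (fun j : Fin (k + 1) => p j.castSucc) ∈ paths k

/-- The directed flag complex of `G`: the directed cliques of `G`. -/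
def dFl {V : Type u} (G : Digraph V) : PathComplex V where
  paths k := {p | Function.Injective p ∧ ∀ i j : Fin (k + 1), i < j → G.Adj (p i) (p j)}
  singleton_mem v := ⟨fun i j _ => Fin.ext (by omega),
    fun i j h => absurd h (by rw [Fin.lt_def]; omega)⟩
  tail_mem _ _ hp := ⟨fun _ _ h => Fin.succ_injective _ (hp.1 h),
    fun i j h => hp.2 _ _ (Fin.succ_lt_succ_iff.2 h)⟩
  init_mem _ _ hp := ⟨fun _ _ h => Fin.castSucc_injective _ (hp.1 h),
    fun i j h => hp.2 _ _ (Fin.castSucc_lt_castSucc_iff.2 h)⟩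

/-! ### The regular chain complex of a regular path complex -/

section Chains

variable (K : Type v) [Field K] {V : Type u}

/-- `Λ_k`: the free vector space on all elementary `k`-paths on `V`. -/
abbrev Lam (V : Type u) (k : ℕ) : Type (max u v) := ElemPath V k →₀ K

/-- The non-regular boundary map `v₀ … v_{k+1} ↦ ∑ᵢ (-1)ⁱ v₀ … v̂ᵢ … v_{k+1}`. -/
def bdNonreg (V : Type u) (k : ℕ) : Lam K V (k + 1) →ₗ[K] Lam K V k :=
  Finsupp.linearCombination K fun p : ElemPath V (k + 1) =>
    ∑ i : Fin (k + 2), (-1 : K) ^ (i : ℕ) • Finsupp.single (p.face i) (1 : K)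

open Classical in
/-- The projection of `Λ_k = R_k ⊕ I_k` onto the span `R_k` of the regular paths, along the span
`I_k` of the irregular ones. -/
def regProj (V : Type u) (k : ℕ) : Lam K V k →ₗ[K] Lam K V k :=
  Finsupp.linearCombination K fun p : ElemPath V k =>
    if p.IsRegular then Finsupp.single p (1 : K) else 0

/-- The regular boundary map: the usual boundary with the irregular summands dropped. -/
def bd (V : Type u) (k : ℕ) : Lam K V (k + 1) →ₗ[K] Lam K V k :=
  regProj K V k ∘ₗ bdNonreg K V k

/-- `C_k(P)`: the span of the `k`-paths of `P`. -/
def pathChains (P : PathComplex V) (k : ℕ) : Submodule K (Lam K V k) :=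
  Finsupp.supported K K (P.paths k)

/-- `Ω_k(P)`: the chains in `C_k(P)` whose regular boundary lies in `C_{k-1}(P)`. -/
def Omega (P : PathComplex V) : ∀ k : ℕ, Submodule K (Lam K V k)
  | 0 => pathChains K P 0
  | k + 1 => pathChains K P (k + 1) ⊓ (pathChains K P k).comap (bd K V k)

theorem bdNonreg_single (k : ℕ) (p : ElemPath V (k + 1)) :
    bdNonreg K V k (Finsupp.single p 1) =
      ∑ i : Fin (k + 2), (-1 : K) ^ (i : ℕ) • Finsupp.single (p.face i) (1 : K) := by
  simp [bdNonreg, Finsupp.linearCombination_single]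

open Classical in
theorem regProj_single (k : ℕ) (p : ElemPath V k) :
    regProj K V k (Finsupp.single p 1) =
      if p.IsRegular then Finsupp.single p (1 : K) else 0 := by
  simp [regProj, Finsupp.linearCombination_single]

theorem bdNonreg_bdNonreg (k : ℕ) : bdNonreg K V k ∘ₗ bdNonreg K V (k + 1) = 0 := by
  refine Finsupp.lhom_ext' fun p => LinearMap.ext_ring ?_
  simp only [LinearMap.comp_apply, Finsupp.lsingle_apply, bdNonreg_single, map_sum, map_smul,
    LinearMap.zero_apply, Finset.smul_sum, smul_smul]
  rw [← Finset.sum_product']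
  refine Finset.sum_involution
    (fun ij _ => (ij.1.succAbove ij.2, ij.2.predAbove ij.1)) ?_ ?_ ?_ ?_
  · rintro ⟨i, j⟩ -
    have hface : (p.face (i.succAbove j)).face (j.predAbove i) = (p.face i).face j := by
      funext l
      simp only [ElemPath.face, Fin.succAbove_succAbove_succAbove_predAbove]
    dsimp only
    rw [hface, ← pow_add, ← pow_add, Fin.neg_one_pow_succAbove_add_predAbove, neg_smul,
      add_neg_cancel]
  · rintro ⟨i, j⟩ - - h
    exact Fin.succAbove_ne i j (congrArg Prod.fst h)
  · simp
  · rintro ⟨i, j⟩ -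
    exact Prod.ext (Fin.succAbove_succAbove_predAbove i j) (Fin.predAbove_predAbove_succAbove i j)

theorem regProj_bdNonreg_of_irregular (k : ℕ) (p : ElemPath V (k + 1)) (hp : ¬ p.IsRegular) :
    regProj K V k (bdNonreg K V k (Finsupp.single p 1)) = 0 := by
  classical
  obtain ⟨j, hj⟩ : ∃ j : Fin (k + 1), p j.castSucc = p j.succ := by
    simpa [ElemPath.IsRegular] using hp
  rw [bdNonreg_single, map_sum]
  have hface : p.face j.castSucc = p.face j.succ := by
    funext l
    rcases lt_trichotomy l j with h | h | h
    · simp only [ElemPath.face]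
      rw [Fin.succAbove_of_castSucc_lt _ _ (Fin.castSucc_lt_castSucc_iff.2 h),
        Fin.succAbove_of_castSucc_lt _ _ (by rw [Fin.lt_def] at h ⊢; simp; omega)]
    · subst h
      simp only [ElemPath.face, Fin.succAbove_castSucc_self, Fin.succAbove_succ_self, hj]
    · simp only [ElemPath.face]
      rw [Fin.succAbove_of_le_castSucc _ _ (Fin.castSucc_le_castSucc_iff.2 h.le),
        Fin.succAbove_of_le_castSucc _ _ (by rw [Fin.lt_def] at h; rw [Fin.le_def]; simp; omega)]
  rw [Finset.sum_eq_add j.castSucc j.succ (by simp [Fin.ext_iff])]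
  · rw [hface, ← map_add, ← add_smul]
    simp [pow_succ]
  · rintro i - ⟨h1, h2⟩
    rw [map_smul, regProj_single, if_neg, smul_zero]
    intro hreg
    have h1' : (i : ℕ) ≠ j := fun h => h1 (Fin.ext h)
    have h2' : (i : ℕ) ≠ j + 1 := fun h => h2 (Fin.ext h)
    have hi := i.isLt
    have hjl := j.isLt
    rcases lt_or_gt_of_ne h1' with h | h
    · have e1 : i.succAbove (Fin.castSucc (⟨j - 1, by omega⟩ : Fin k)) = j.castSucc := by
        rw [Fin.succAbove_of_le_castSucc _ _ (by rw [Fin.le_def]; simp; omega)]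
        ext; simp; omega
      have e2 : i.succAbove (Fin.succ (⟨j - 1, by omega⟩ : Fin k)) = j.succ := by
        rw [Fin.succAbove_of_le_castSucc _ _ (by rw [Fin.le_def]; simp; omega)]
        ext; simp; omega
      refine hreg ⟨j - 1, by omega⟩ ?_
      simp only [ElemPath.face]
      rw [e1, e2, hj]
    · have e1 : i.succAbove (Fin.castSucc (⟨j, by omega⟩ : Fin k)) = j.castSucc := by
        rw [Fin.succAbove_of_castSucc_lt _ _ (by rw [Fin.lt_def]; simp; omega)]
        ext; simp
      have e2 : i.succAbove (Fin.succ (⟨j, by omega⟩ : Fin k)) = j.succ := by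
        rw [Fin.succAbove_of_castSucc_lt _ _ (by rw [Fin.lt_def]; simp; omega)]
        ext; simp
      refine hreg ⟨j, by omega⟩ ?_
      simp only [ElemPath.face]
      rw [e1, e2, hj]
  · simp
  · simp

theorem regProj_bdNonreg_regProj (k : ℕ) :
    regProj K V k ∘ₗ bdNonreg K V k ∘ₗ regProj K V (k + 1) = regProj K V k ∘ₗ bdNonreg K V k := by
  classical
  refine Finsupp.lhom_ext' fun p => LinearMap.ext_ring ?_
  simp only [LinearMap.comp_apply, Finsupp.lsingle_apply, regProj_single]
  split_ifs with h
  · rfl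
  · rw [regProj_bdNonreg_of_irregular K k p h, map_zero, map_zero]

theorem bd_bd (k : ℕ) : bd K V k ∘ₗ bd K V (k + 1) = 0 := by
  have h : bd K V k ∘ₗ bd K V (k + 1) =
      (regProj K V k ∘ₗ bdNonreg K V k ∘ₗ regProj K V (k + 1)) ∘ₗ bdNonreg K V (k + 1) := rfl
  rw [h, regProj_bdNonreg_regProj, LinearMap.comp_assoc, bdNonreg_bdNonreg, LinearMap.comp_zero]

theorem bd_mem_Omega (P : PathComplex V) (k : ℕ) {c : Lam K V (k + 1)}
    (hc : c ∈ Omega K P (k + 1)) : bd K V k c ∈ Omega K P k := by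
  cases k with
  | zero => exact hc.2
  | succ k =>
    refine ⟨hc.2, ?_⟩
    have h : bd K V k (bd K V (k + 1) c) = 0 := LinearMap.congr_fun (bd_bd K k) c
    change bd K V k (bd K V (k + 1) c) ∈ pathChains K P k
    rw [h]
    exact Submodule.zero_mem _

theorem pathChains_mono {P Q : PathComplex V} (h : ∀ k, P.paths k ⊆ Q.paths k) (k : ℕ) :
    pathChains K P k ≤ pathChains K Q k :=
  Finsupp.supported_mono (h k)

theorem Omega_mono {P Q : PathComplex V} (h : ∀ k, P.paths k ⊆ Q.paths k) (k : ℕ) :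
    Omega K P k ≤ Omega K Q k := by
  cases k with
  | zero => exact pathChains_mono K h 0
  | succ k => exact inf_le_inf (pathChains_mono K h _) (Submodule.comap_mono (pathChains_mono K h _))

end Chains

theorem dFl_mono {V : Type u} {G H : Digraph V} (h : G ≤ H) (k : ℕ) :
    (dFl G).paths k ⊆ (dFl H).paths k :=
  fun _ hp => ⟨hp.1, fun i j hij => h (hp.2 i j hij)⟩

/-! ### Maps of digraphs and homotopies -/

section Maps

variable {V W : Type u}

/-- `v ⇒ w`: either `v = w` or there is an edge `v → w`. -/
def AdjOrEq (G : Digraph V) (v w : V) : Prop := v = w ∨ G.Adj v w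

/-- Weak digraph maps. -/
def IsWeakMap (G : Digraph V) (H : Digraph W) (f : V → W) : Prop :=
  ∀ v w : V, G.Adj v w → f v = f w ∨ H.Adj (f v) (f w)

/-- Triangle-collapsing digraph maps. -/
def IsTriangleCollapsing (G : Digraph V) (H : Digraph W) (f : V → W) : Prop :=
  IsWeakMap G H f ∧ ∀ p ∈ (dFl G).paths 2, f (p 0) = f (p 2) →
    f (p 0) = f (p 1) ∧ f (p 1) = f (p 2)

/-- The triangle-collapsing digraph maps `G → H`. -/
abbrev TcMap (G : Digraph V) (H : Digraph W) : Type u :=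
  {f : V → W // IsTriangleCollapsing G H f}

/-- There is a one-step homotopy from `f` to `g` in the directed flag system. -/
def OneStep {G : Digraph V} {H : Digraph W} (f g : TcMap G H) : Prop :=
  (∀ x y : V, AdjOrEq G x y → AdjOrEq H (f.1 x) (g.1 y)) ∧
  (∀ x y : V, G.Adj x y → f.1 x = g.1 y →
    f.1 x = f.1 y ∧ f.1 y = g.1 x ∧ g.1 x = g.1 y)

/-- One-step homotopies relative to `A`. -/
def OneStepRel {G : Digraph V} {H : Digraph W} (A : Set V) (f g : TcMap G H) : Prop :=
  OneStep f g ∧ ∀ v ∈ A, f.1 v = g.1 v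

/-- `f` and `g` are homotopic relative to `A`: the equivalence relation generated by one-step
homotopies relative to `A`. -/
def HomotopicRel {G : Digraph V} {H : Digraph W} (A : Set V) (f g : TcMap G H) : Prop :=
  Relation.EqvGen (OneStepRel A) f g

end Maps

/-! ### Weighted digraphs and the shortest-path filtration -/

/-- A (simple) weighted digraph with vertex set `V`. -/
structure WDigraph (V : Type u) extends Digraph V where
  loopless : ∀ v : V, ¬ Adj v v
  weight : ∀ v w : V, Adj v w → ℝ
  weight_pos : ∀ (v w : V) (h : Adj v w), 0 < weight v w h

namespace WDigraph

variable {V W : Type u}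

/-- Paths in a weighted digraph: non-empty sequences of composable edges. -/
inductive Path (G : WDigraph V) : V → V → Type u
  | single {i j : V} (h : G.Adj i j) : Path G i j
  | cons {i j k : V} (h : G.Adj i j) (p : Path G j k) : Path G i k

/-- The length of a path is the sum of the weights of its edges. -/
def Path.length {G : WDigraph V} : ∀ {i j : V}, G.Path i j → ℝ
  | _, _, .single h => G.weight _ _ h
  | _, _, .cons h p => G.weight _ _ h + p.length

/-- The shortest-path filtration at time `t`, as a simple digraph. -/
def SP (G : WDigraph V) (t : ℝ) : Digraph V where
  Adj i j := i ≠ j ∧ ∃ p : G.Path i j, p.length ≤ t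

/-- The union `G ∪ SP(G)_t`. -/
def unionSP (G : WDigraph V) (t : ℝ) : Digraph V := G.toDigraph ⊔ G.SP t

theorem SP_mono (G : WDigraph V) {s t : ℝ} (h : s ≤ t) : G.SP s ≤ G.SP t :=
  fun _ _ hij => ⟨hij.1, hij.2.imp fun _ hp => hp.trans h⟩

theorem unionSP_mono (G : WDigraph V) {s t : ℝ} (h : s ≤ t) : G.unionSP s ≤ G.unionSP t :=
  fun _ _ hij => hij.imp id (fun h' => G.SP_mono h h')

/-- Path-collapsing: if `i ⇝ j ⇝ k` for distinct vertices `i, j, k` and `f i = f k`, then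
`f i = f j = f k`. (Without distinctness the identity of a digraph with a directed cycle would not
be path-collapsing.) -/
def IsPathCollapsing (G : WDigraph V) (f : V → W) : Prop :=
  ∀ i j k : V, i ≠ j → j ≠ k → i ≠ k → Nonempty (G.Path i j) → Nonempty (G.Path j k) →
    f i = f k → f i = f j ∧ f j = f k

/-- `δ`-shifting vertex maps; the filtration parameter ranges over `[0, ∞)`. -/
def IsShifting (G : WDigraph V) (H : WDigraph W) (δ : ℝ≥0) (f : V → W) : Prop :=
  ∀ t : ℝ≥0, IsWeakMap (G.SP t) (H.SP (t + δ)) f ∧ IsWeakMap (G.unionSP t) (H.unionSP (t + δ)) f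

/-- `V_fix(g, f)`. -/
def Vfix (g : W → V) (f : V → W) : Set V := {v | g (f v) = v}

/-- `G_diff(g, f)`: the digraph on `V(G)` of the edges of `G` which `g ∘ f` does not fix. -/
def Gdiff (G : WDigraph V) (g : W → V) (f : V → W) : Digraph V where
  Adj i j := G.Adj i j ∧ (g (f i), g (f j)) ≠ (i, j)

/-- `(g, f)` has grounded codistortion at most `δ` (for the directed flag system). -/
def GroundedCodistortionLE (G : WDigraph V) (g : W → V) (f : V → W) (δ : ℝ≥0) : Prop :=
  ∃ (hid : IsTriangleCollapsing (G.Gdiff g f) (G.SP (2 * δ)) id)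
    (hgf : IsTriangleCollapsing (G.Gdiff g f) (G.SP (2 * δ)) (g ∘ f)),
    HomotopicRel (Vfix g f) (⟨id, hid⟩ : TcMap (G.Gdiff g f) (G.SP (2 * δ))) ⟨g ∘ f, hgf⟩

/-- `f` and `g` form a `δ`-grounded interleaving (for the directed flag system). -/
structure IsGroundedInterleaving (G : WDigraph V) (H : WDigraph W) (δ : ℝ≥0)
    (f : V → W) (g : W → V) : Prop where
  pathCollapsing_left : G.IsPathCollapsing f
  pathCollapsing_right : H.IsPathCollapsing g
  shifting_left : IsShifting G H δ f
  shifting_right : IsShifting H G δ g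
  codistortion_left : GroundedCodistortionLE G g f δ
  codistortion_right : GroundedCodistortionLE H f g δ

/-! ### Grounded persistent directed flag homology -/

section Grounded

variable (K : Type v) [Field K] (G : WDigraph V)

/-- The chain groups of the grounded complex at time `t`: `Ω_k(dFl(G ∪ SP(G)_t))` for `k ≤ 1` and
`Ω_k(dFl(SP(G)_t))` for `k ≥ 2`. -/
def groundedChains (t : ℝ≥0) : ∀ k : ℕ, Submodule K (Lam K V k)
  | 0 => Omega K (dFl (G.unionSP t)) 0
  | 1 => Omega K (dFl (G.unionSP t)) 1
  | k + 2 => Omega K (dFl (G.SP t)) (k + 2)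

theorem bd_mem_groundedChains (t : ℝ≥0) (k : ℕ) :
    ∀ c ∈ groundedChains K G t (k + 1), bd K V k c ∈ groundedChains K G t k := by
  intro c hc
  match k, c, hc with
  | 0, c, hc => exact bd_mem_Omega K _ 0 hc
  | 1, c, hc =>
    exact Omega_mono K (dFl_mono (le_sup_right : G.SP t ≤ G.unionSP t)) 1
      (bd_mem_Omega K _ 1 hc)
  | k + 2, c, hc => exact bd_mem_Omega K _ (k + 2) hc

theorem groundedChains_mono {s t : ℝ≥0} (h : s ≤ t) (k : ℕ) :
    groundedChains K G s k ≤ groundedChains K G t k := by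
  have h' : (s : ℝ) ≤ t := h
  match k with
  | 0 => exact Omega_mono K (dFl_mono (G.unionSP_mono h')) 0
  | 1 => exact Omega_mono K (dFl_mono (G.unionSP_mono h')) 1
  | k + 2 => exact Omega_mono K (dFl_mono (G.SP_mono h')) (k + 2)

/-- The boundary maps of the grounded complex. -/
def groundedBd (t : ℝ≥0) (k : ℕ) :
    groundedChains K G t (k + 1) →ₗ[K] groundedChains K G t k :=
  (bd K V k).restrict (bd_mem_groundedChains K G t k)

theorem groundedBd_comp (t : ℝ≥0) (k : ℕ) :
    groundedBd K G t k ∘ₗ groundedBd K G t (k + 1) = 0 :=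
  LinearMap.ext fun c => Subtype.ext (LinearMap.congr_fun (bd_bd K k) c.1)

/-- The grounded chain complex of `G` at time `t`. -/
def groundedComplex (t : ℝ≥0) : ChainComplex (ModuleCat.{max u v} K) ℕ :=
  ChainComplex.of (fun k => ModuleCat.of K (groundedChains K G t k))
    (fun k => ModuleCat.ofHom (groundedBd K G t k))
    (fun k => by rw [← ModuleCat.ofHom_comp, groundedBd_comp, ModuleCat.ofHom_zero])

/-- The inclusion of grounded complexes for `s ≤ t`. -/
def groundedInclusion {s t : ℝ≥0} (h : s ≤ t) : groundedComplex K G s ⟶ groundedComplex K G t :=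
  ChainComplex.ofHom
    (fun k => ModuleCat.ofHom (Submodule.inclusion (groundedChains_mono K G h k)))
    (fun k => by
      simp only [groundedComplex, ChainComplex.of_d]
      rfl)

/-- The persistent grounded chain complex of `G`. -/
def persistentGroundedComplex : ℝ≥0 ⥤ ChainComplex (ModuleCat.{max u v} K) ℕ where
  obj t := groundedComplex K G t
  map h := groundedInclusion K G (leOfHom h)
  map_id _ := by
    ext k : 1
    rfl
  map_comp _ _ := by
    ext k : 1
    rfl

/-- Grounded persistent directed flag homology of `G`, with coefficients in `K`. -/
def groundedHomology : ℝ≥0 ⥤ ModuleCat.{max u v} K :=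
  persistentGroundedComplex K G ⋙ HomologicalComplex.homologyFunctor _ _ 1

end Grounded

end WDigraph

/-! ### The interleaving distance -/

section Interleaving

variable {C : Type*} [Category C]

/-- The `δ`-shift `M(· + δ)` of a persistent object. -/
def shift (M : ℝ≥0 ⥤ C) (δ : ℝ≥0) : ℝ≥0 ⥤ C where
  obj t := M.obj (t + δ)
  map h := M.map (homOfLE (add_le_add_left (leOfHom h) δ))
  map_id t := M.map_id (t + δ)
  map_comp _ _ := M.map_comp _ _

/-- `M` and `N` are `δ`-interleaved. -/
def IsInterleaved (M N : ℝ≥0 ⥤ C) (δ : ℝ≥0) : Prop :=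
  ∃ (φ : M ⟶ shift N δ) (ψ : N ⟶ shift M δ),
    (∀ t : ℝ≥0, φ.app t ≫ ψ.app (t + δ) =
      M.map (homOfLE (le_self_add.trans le_self_add : t ≤ t + δ + δ))) ∧
    (∀ t : ℝ≥0, ψ.app t ≫ φ.app (t + δ) =
      N.map (homOfLE (le_self_add.trans le_self_add : t ≤ t + δ + δ)))

/-- The interleaving distance, with values in `[0, ∞]`. -/
def interleavingDist (M N : ℝ≥0 ⥤ C) : ℝ≥0∞ :=
  ⨅ (δ : ℝ≥0) (_ : IsInterleaved M N δ), (δ : ℝ≥0∞)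

end Interleaving

end GroundedFlag

end

/-! A vertex map acts on chains, irregular images being dropped. Path-collapsing makes cliques of
`SP` with regular image go to cliques, and shifting bounds the filtration parameter, so `f` and `g`
induce chain maps from time `t` to time `t + δ`, and hence the two natural transformations
(`groundedHomologyPush`).

It remains to see that `(g ∘ f)_* c - c` bounds at time `t + 2δ` for each 1-cycle `c`. The homotopy
from `id` to `g ∘ f` gives, by a prism argument, a function `L` on vertices such that `(g ∘ f)_* -
id - L ∘ ∂` (`defect`) sends each edge of `G_diff` to a boundary (`HomotopicRel.exists_correction`).
The homotopy is relative to `V_fix`, so `L` vanishes there and the defect of every other edge of `G`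
is zero. An edge of `SP(G)_t` is, modulo boundaries of triangles, a sum of edges of `G` along a
path; the defect preserves boundaries, so it sends every 1-chain to a boundary
(`push_sub_mem_boundaries`). On cycles the term `L ∘ ∂` disappears. -/

noncomputable section

namespace GroundedFlag

/-! ### The maps on chains induced by vertex maps -/

section Push

variable (K : Type v) [Field K] {U V W : Type u}

/-- The map `Λ_k(V) → Λ_k(W)` induced by a vertex map, with irregular images dropped. -/
def push (f : V → W) (k : ℕ) : Lam K V k →ₗ[K] Lam K W k :=
  regProj K W k ∘ₗ Finsupp.lmapDomain K K fun p : ElemPath V k => (f ∘ p : ElemPath W k)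

theorem ElemPath.IsRegular.of_comp {k : ℕ} {f : V → W} {p : ElemPath V k}
    (h : ElemPath.IsRegular (f ∘ p : ElemPath W k)) : p.IsRegular :=
  fun i hi => h i (congrArg f hi)

theorem push_single (f : V → W) (k : ℕ) (p : ElemPath V k) :
    push K f k (Finsupp.single p 1) =
      regProj K W k (Finsupp.single (f ∘ p : ElemPath W k) 1) := by
  simp [push, Finsupp.mapDomain_single]

/-- A vertex map keeps irregular paths irregular, so `push` kills them. This gives functoriality and
lets projections be inserted or removed freely. -/
theorem push_regProj (f : V → W) (k : ℕ) : push K f k ∘ₗ regProj K V k = push K f k := by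
  classical
  refine Finsupp.lhom_ext' fun p => LinearMap.ext_ring ?_
  simp only [LinearMap.comp_apply, Finsupp.lsingle_apply, regProj_single]
  split_ifs with h
  · rfl
  · rw [map_zero, push_single, regProj_single, if_neg fun h' => h h'.of_comp]

theorem push_comp (g : V → W) (f : U → V) (k : ℕ) :
    push K g k ∘ₗ push K f k = push K (g ∘ f) k := by
  refine Finsupp.lhom_ext' fun p => LinearMap.ext_ring ?_
  simp only [LinearMap.comp_apply, Finsupp.lsingle_apply]
  rw [push_single, ← LinearMap.comp_apply (push K g k), push_regProj, push_single, push_single]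
  rfl

theorem bd_regProj (k : ℕ) : bd K V k ∘ₗ regProj K V (k + 1) = bd K V k := by
  rw [bd, LinearMap.comp_assoc, regProj_bdNonreg_regProj]

/-- Both sides ignore irregular paths, so the inner projections can be removed; what remains is that
taking faces commutes with composing with `f`. -/
theorem bd_push (f : V → W) (k : ℕ) : bd K W k ∘ₗ push K f (k + 1) = push K f k ∘ₗ bd K V k := by
  have h1 : bd K W k ∘ₗ push K f (k + 1) = bd K W k ∘ₗ
      Finsupp.lmapDomain K K fun p : ElemPath V (k + 1) => (f ∘ p : ElemPath W (k + 1)) := by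
    rw [push, ← LinearMap.comp_assoc, bd_regProj]
  have h2 : push K f k ∘ₗ bd K V k = push K f k ∘ₗ bdNonreg K V k := by
    rw [bd, ← LinearMap.comp_assoc, push_regProj]
  rw [h1, h2]
  refine Finsupp.lhom_ext' fun p => LinearMap.ext_ring ?_
  simp only [LinearMap.comp_apply, Finsupp.lsingle_apply, bd, Finsupp.lmapDomain_apply,
    Finsupp.mapDomain_single, bdNonreg_single, map_sum, map_smul, push_single]
  rfl

theorem bd_push_apply (f : V → W) (k : ℕ) (c : Lam K V (k + 1)) :
    bd K W k (push K f (k + 1) c) = push K f k (bd K V k c) :=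
  LinearMap.congr_fun (bd_push K f k) c

theorem pathChains_le_iff {P : PathComplex V} {k : ℕ} {S : Submodule K (Lam K V k)} :
    pathChains K P k ≤ S ↔ ∀ p ∈ P.paths k, Finsupp.single p (1 : K) ∈ S := by
  rw [pathChains, Finsupp.supported_eq_span_single, Submodule.span_le]
  exact Set.forall_mem_image

theorem single_mem_pathChains {P : PathComplex V} {k : ℕ} {p : ElemPath V k}
    (hp : p ∈ P.paths k) : Finsupp.single p (1 : K) ∈ pathChains K P k :=
  Finsupp.single_mem_supported K 1 hp

theorem regProj_single_mem {P : PathComplex V} {k : ℕ} {p : ElemPath V k}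
    (hp : p.IsRegular → p ∈ P.paths k) :
    regProj K V k (Finsupp.single p 1) ∈ pathChains K P k := by
  classical
  rw [regProj_single]
  split_ifs with h
  · exact single_mem_pathChains K (hp h)
  · exact Submodule.zero_mem _

theorem isRegular_of_mem_dFl {G : Digraph V} {k : ℕ} {p : ElemPath V k}
    (hp : p ∈ (dFl G).paths k) : p.IsRegular :=
  fun i h => (Fin.castSucc_lt_succ (i := i)).ne (hp.1 h)

theorem regProj_single_of_mem_dFl {G : Digraph V} {k : ℕ} {p : ElemPath V k}
    (hp : p ∈ (dFl G).paths k) :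
    regProj K V k (Finsupp.single p 1) = Finsupp.single p 1 := by
  classical
  rw [regProj_single, if_pos (isRegular_of_mem_dFl hp)]

theorem face_mem_dFl {G : Digraph V} {k : ℕ} {p : ElemPath V (k + 1)}
    (hp : p ∈ (dFl G).paths (k + 1)) (i : Fin (k + 2)) : p.face i ∈ (dFl G).paths k :=
  ⟨fun _ _ h => Fin.succAbove_right_injective (hp.1 h),
    fun _ _ h => hp.2 _ _ (Fin.strictMono_succAbove i h)⟩

/-- For a directed flag complex every chain is `∂`-allowed. -/
theorem Omega_dFl (G : Digraph V) (k : ℕ) : Omega K (dFl G) k = pathChains K (dFl G) k := by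
  cases k with
  | zero => rfl
  | succ k =>
    refine inf_eq_left.2 ?_
    rw [pathChains_le_iff]
    intro p hp
    rw [Submodule.mem_comap, bd, LinearMap.comp_apply, bdNonreg_single, map_sum]
    refine Submodule.sum_mem _ fun i _ => ?_
    rw [map_smul]
    exact Submodule.smul_mem _ _ (regProj_single_mem K fun _ => face_mem_dFl hp i)

/-- A regular image such as `a b a` need not be a clique; `hinj` rules this out, and irregular
images contribute zero. -/
theorem push_mem_pathChains {G : Digraph V} {H : Digraph W} {f : V → W} (hf : IsWeakMap G H f)
    {k : ℕ} (hinj : ∀ p ∈ (dFl G).paths k, ElemPath.IsRegular (f ∘ p : ElemPath W k) →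
      Function.Injective (f ∘ p)) {c : Lam K V k} (hc : c ∈ pathChains K (dFl G) k) :
    push K f k c ∈ pathChains K (dFl H) k := by
  have h : pathChains K (dFl G) k ≤ (pathChains K (dFl H) k).comap (push K f k) := by
    rw [pathChains_le_iff]
    intro p hp
    rw [Submodule.mem_comap, push_single]
    refine regProj_single_mem K fun hreg => ?_
    have hi := hinj p hp hreg
    exact ⟨hi, fun i j hij => (hf _ _ (hp.2 i j hij)).resolve_left (hi.ne hij.ne)⟩
  exact h hc

end Push

/-! ### Edges, triangles and boundaries in low degrees -/

section LowDegree

variable (K : Type v) [Field K] {V W : Type u}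

/-- The edge `x y` as a `1`-chain; it vanishes if `x = y`. -/
def edge (x y : V) : Lam K V 1 := regProj K V 1 (Finsupp.single ![x, y] 1)

/-- The triangle `x y z` as a `2`-chain; it vanishes if it is irregular. -/
def triangle (x y z : V) : Lam K V 2 := regProj K V 2 (Finsupp.single ![x, y, z] 1)

theorem edge_self (x : V) : edge K x x = 0 := by
  classical
  rw [edge, regProj_single, if_neg]
  intro h
  exact h 0 rfl

theorem push_edge (f : V → W) (x y : V) : push K f 1 (edge K x y) = edge K (f x) (f y) := by
  have h : (f ∘ ![x, y] : ElemPath W 1) = ![f x, f y] := by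
    funext i; fin_cases i <;> rfl
  rw [edge, ← LinearMap.comp_apply (push K f 1), push_regProj, push_single, h, edge]

/-- Valid for degenerate triples too, since `bd` is insensitive to irregular paths; no case split is
needed later. -/
theorem bd_triangle (x y z : V) :
    bd K V 1 (triangle K x y z) = edge K y z - edge K x z + edge K x y := by
  have h0 : ElemPath.face (![x, y, z] : ElemPath V 2) 0 = ![y, z] := by
    funext i; fin_cases i <;> rfl
  have h1 : ElemPath.face (![x, y, z] : ElemPath V 2) 1 = ![x, z] := by
    funext i; fin_cases i <;> rfl
  have h2 : ElemPath.face (![x, y, z] : ElemPath V 2) 2 = ![x, y] := by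
    funext i; fin_cases i <;> rfl
  rw [triangle, ← LinearMap.comp_apply (bd K V 1), bd_regProj, bd, LinearMap.comp_apply,
    bdNonreg_single, Fin.sum_univ_three, h0, h1, h2]
  simp [edge, sub_eq_add_neg]

theorem bd_edge (x y : V) :
    bd K V 0 (edge K x y) = Finsupp.single ![y] 1 - Finsupp.single ![x] 1 := by
  have hr (v : V) : regProj K V 0 (Finsupp.single ![v] 1) = Finsupp.single ![v] 1 := by
    classical
    have h : ElemPath.IsRegular (![v] : ElemPath V 0) := fun i => i.elim0
    rw [regProj_single, if_pos h]
  have h0 : ElemPath.face (![x, y] : ElemPath V 1) 0 = ![y] := by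
    funext i; fin_cases i; rfl
  have h1 : ElemPath.face (![x, y] : ElemPath V 1) 1 = ![x] := by
    funext i; fin_cases i; rfl
  rw [edge, ← LinearMap.comp_apply (bd K V 0), bd_regProj, bd, LinearMap.comp_apply,
    bdNonreg_single, Fin.sum_univ_two, h0, h1]
  simp [hr, sub_eq_add_neg]

theorem single_eq_edge {G : Digraph V} {p : ElemPath V 1} (hp : p ∈ (dFl G).paths 1) :
    Finsupp.single p (1 : K) = edge K (p 0) (p 1) := by
  have h : p = ![p 0, p 1] := by
    funext i; fin_cases i <;> rfl
  rw [edge, ← h, regProj_single_of_mem_dFl K hp]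

/-- The boundaries of the directed `3`-cliques of `G`. -/
def triangleBoundaries (G : Digraph V) : Submodule K (Lam K V 1) :=
  (pathChains K (dFl G) 2).map (bd K V 1)

theorem triangleBoundaries_mono {G H : Digraph V} (h : G ≤ H) :
    triangleBoundaries K G ≤ triangleBoundaries K H :=
  Submodule.map_mono (pathChains_mono K (dFl_mono h) 2)

/-- Triples with equal neighbours give the zero chain, so the only bad case is `x y x` with `x ≠ y`,
which `h` excludes. -/
theorem triangle_mem {G : Digraph V} {x y z : V} (hxy : AdjOrEq G x y) (hyz : AdjOrEq G y z)
    (hxz : AdjOrEq G x z) (h : x = z → x = y) :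
    triangle K x y z ∈ pathChains K (dFl G) 2 := by
  refine regProj_single_mem K fun hreg => ?_
  have n1 : x ≠ y := hreg 0
  have n2 : y ≠ z := hreg 1
  have n3 : x ≠ z := fun e => n1 (h e)
  have a1 := hxy.resolve_left n1
  have a2 := hyz.resolve_left n2
  have a3 := hxz.resolve_left n3
  constructor
  · intro i j hij
    fin_cases i <;> fin_cases j <;> simp_all
  · intro i j hij
    fin_cases i <;> fin_cases j <;> simp_all

/-- Homotopic triangle-collapsing maps agree on edges, up to boundaries and a correction term
which depends on the end points and vanishes on the fixed set. -/
theorem HomotopicRel.exists_correction {G : Digraph V} {H : Digraph W} {A : Set V}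
    {f g : TcMap G H} (h : HomotopicRel A f g) :
    ∃ L : V → Lam K W 1, (∀ v ∈ A, L v = 0) ∧ ∀ x y, G.Adj x y →
      edge K (g.1 x) (g.1 y) - edge K (f.1 x) (f.1 y) - (L y - L x) ∈ triangleBoundaries K H := by
  induction h with
  | rel f g hfg =>
    obtain ⟨⟨h1, h2⟩, h3⟩ := hfg
    refine ⟨fun v => edge K (f.1 v) (g.1 v), fun v hv => by simp only [h3 v hv, edge_self],
      fun x y hxy => ?_⟩
    -- The prism over `x → y` is cut along the diagonal from `f x` to `g y`. If the diagonal
    -- degenerates, condition (ii) collapses the whole prism. In the difference of the two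
    -- boundaries the diagonal cancels.
    have t1 : triangle K (f.1 x) (g.1 x) (g.1 y) ∈ pathChains K (dFl H) 2 :=
      triangle_mem K (h1 x x (.inl rfl)) (g.2.1 x y hxy) (h1 x y (.inr hxy))
        fun e => let ⟨a, b, _⟩ := h2 x y hxy e; a.trans b
    have t2 : triangle K (f.1 x) (f.1 y) (g.1 y) ∈ pathChains K (dFl H) 2 :=
      triangle_mem K (f.2.1 x y hxy) (h1 y y (.inl rfl)) (h1 x y (.inr hxy))
        fun e => (h2 x y hxy e).1
    refine ⟨_, sub_mem t1 t2, ?_⟩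
    rw [map_sub, bd_triangle, bd_triangle]
    abel
  | refl f => exact ⟨0, fun _ _ => rfl, fun x y _ => by simp⟩
  | symm f g _ ih =>
    obtain ⟨L, hL, h⟩ := ih
    refine ⟨-L, fun v hv => by simp [hL v hv], fun x y hxy => ?_⟩
    convert neg_mem (h x y hxy) using 1
    simp only [Pi.neg_apply]
    abel
  | trans f g k _ _ ih1 ih2 =>
    obtain ⟨L, hL, h⟩ := ih1
    obtain ⟨L', hL', h'⟩ := ih2
    refine ⟨L + L', fun v hv => by simp [hL v hv, hL' v hv], fun x y hxy => ?_⟩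
    convert add_mem (h x y hxy) (h' x y hxy) using 1
    simp only [Pi.add_apply]
    abel

end LowDegree

/-! ### Chain maps of a grounded interleaving and their composites on 1-cycles -/

namespace WDigraph

variable {V W : Type u}

theorem Path.length_pos {G : WDigraph V} {i j : V} (p : G.Path i j) : 0 < p.length := by
  induction p with
  | single h => exact G.weight_pos _ _ h
  | cons h p ih => exact add_pos (G.weight_pos _ _ h) ih

/-- If `f` identified two non-consecutive vertices `p i` and `p j` of the clique, path-collapsing
through `p (i + 1)` would identify `p i` with its successor, against regularity. -/
theorem IsPathCollapsing.injective_of_isRegular {G : WDigraph V} {f : V → W}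
    (hf : G.IsPathCollapsing f) {t : ℝ} {k : ℕ} {p : ElemPath V k}
    (hp : p ∈ (dFl (G.SP t)).paths k) (hreg : ElemPath.IsRegular (f ∘ p : ElemPath W k)) :
    Function.Injective (f ∘ p) := by
  have key : ∀ i j : Fin (k + 1), i < j → f (p i) ≠ f (p j) := by
    intro i j hij e
    have hij' : (i : ℕ) < j := hij
    have hj := j.isLt
    have hi := hreg ⟨i, by omega⟩
    by_cases hc : (i : ℕ) + 1 = j
    · exact hi (e.trans (congrArg (fun l => f (p l)) (Fin.ext hc.symm)))
    · have h1 : i < (⟨i, by omega⟩ : Fin k).succ := by rw [Fin.lt_def]; simp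
      have h2 : (⟨i, by omega⟩ : Fin k).succ < j := by rw [Fin.lt_def]; simp; omega
      exact hi (hf _ _ _ (hp.1.ne h1.ne) (hp.1.ne h2.ne) (hp.1.ne hij.ne)
        (hp.2 _ _ h1).2.nonempty (hp.2 _ _ h2).2.nonempty e).1
  intro i j e
  by_contra hne
  rcases lt_or_gt_of_ne hne with h | h
  · exact key i j h e
  · exact key j i h e.symm

section Grounded

variable (K : Type v) [Field K] {G : WDigraph V} {H : WDigraph W}

/-- In degrees 0 and 1 a regular path is automatically injective. From degree 2 on the cliques lie
in `SP`, so their edges come from paths and path-collapsing applies. -/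
theorem push_mem_groundedChains {δ : ℝ≥0} {f : V → W} (hc : G.IsPathCollapsing f)
    (hs : IsShifting G H δ f) (t : ℝ≥0) (k : ℕ) :
    ∀ c ∈ groundedChains K G t k, push K f k c ∈ groundedChains K H (t + δ) k := by
  intro c h
  match k, c, h with
  | 0, c, h =>
    simp only [groundedChains, Omega_dFl, NNReal.coe_add] at h ⊢
    refine push_mem_pathChains K (hs t).2 (fun p _ _ i j _ => Fin.ext (by omega)) h
  | 1, c, h =>
    simp only [groundedChains, Omega_dFl, NNReal.coe_add] at h ⊢
    refine push_mem_pathChains K (hs t).2 (fun p _ hreg i j e => ?_) h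
    have := hreg 0
    fin_cases i <;> fin_cases j
    · rfl
    · exact absurd e this
    · exact absurd e.symm this
    · rfl
  | k + 2, c, h =>
    simp only [groundedChains, Omega_dFl, NNReal.coe_add] at h ⊢
    exact push_mem_pathChains K (hs t).1 (fun p hp hreg => hc.injective_of_isRegular hp hreg) h

/-- The chain map from the grounded complex at `t` to that at `t + δ` induced by a
path-collapsing `δ`-shifting map. -/
def groundedPush {δ : ℝ≥0} {f : V → W} (hc : G.IsPathCollapsing f)
    (hs : IsShifting G H δ f) (t : ℝ≥0) :
    groundedComplex K G t ⟶ groundedComplex K H (t + δ) :=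
  ChainComplex.ofHom
    (fun k => ModuleCat.ofHom ((push K f k).restrict (push_mem_groundedChains K hc hs t k)))
    (fun k => by
      simp only [groundedComplex, ChainComplex.of_d]
      rw [← ModuleCat.ofHom_comp, ← ModuleCat.ofHom_comp]
      congr 1
      exact LinearMap.ext fun c => Subtype.ext (bd_push_apply K f k c.1))

/-- The induced map on grounded persistent homology. -/
def groundedHomologyPush {δ : ℝ≥0} {f : V → W} (hc : G.IsPathCollapsing f)
    (hs : IsShifting G H δ f) : groundedHomology K G ⟶ shift (groundedHomology K H) δ where
  app t := HomologicalComplex.homologyMap (groundedPush K hc hs t) 1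
  naturality s t h := by
    -- Both composites restrict the same linear map `push K f`, so they agree definitionally on
    -- chains.
    change HomologicalComplex.homologyMap (groundedInclusion K G (leOfHom h)) 1 ≫ _ =
      _ ≫ HomologicalComplex.homologyMap (groundedInclusion K H (add_le_add_left (leOfHom h) δ)) 1
    rw [← HomologicalComplex.homologyMap_comp, ← HomologicalComplex.homologyMap_comp]
    rfl

/-- The failure of `gf` to be the identity on `1`-chains, corrected by `L`. -/
def defect (e : V → V) (L : V → Lam K V 1) : Lam K V 1 →ₗ[K] Lam K V 1 :=
  push K e 1 - LinearMap.id -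
    Finsupp.linearCombination K (fun p : ElemPath V 0 => L (p 0)) ∘ₗ bd K V 0

theorem defect_edge (e : V → V) (L : V → Lam K V 1) (x y : V) :
    defect K e L (edge K x y) = edge K (e x) (e y) - edge K x y - (L y - L x) := by
  simp [defect, push_edge, bd_edge, Finsupp.linearCombination_single]

theorem defect_bd (e : V → V) (L : V → Lam K V 1) (c : Lam K V 2) :
    defect K e L (bd K V 1 c) = bd K V 1 (push K e 2 c) - bd K V 1 c := by
  have h : bd K V 0 (bd K V 1 c) = 0 := LinearMap.congr_fun (bd_bd K 0) c
  simp [defect, h, bd_push_apply]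

/-- Induction along the path: after a first edge `i → k`, the edge `i j` equals `i k` plus `k j`
minus the boundary of the triangle `i k j`. -/
theorem defect_edge_of_path {e : V → V} {L : V → Lam K V 1} {t : ℝ}
    {S : Submodule K (Lam K V 1)}
    (hG : ∀ x y, G.Adj x y → defect K e L (edge K x y) ∈ S)
    (ht : ∀ c ∈ pathChains K (dFl (G.SP t)) 2, defect K e L (bd K V 1 c) ∈ S)
    {i j : V} (p : G.Path i j) (hp : p.length ≤ t) (hij : i ≠ j) :
    defect K e L (edge K i j) ∈ S := by
  induction p with
  | single h => exact hG _ _ h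
  | @cons i k j h p ih =>
    -- If `k = j` the rest of the path is closed, and `(i, j)` is already an edge of `G`.
    by_cases hkj : k = j
    · subst hkj
      exact hG _ _ h
    have hw := G.weight_pos _ _ h
    have hl := p.length_pos
    have hlen : (Path.cons h p).length = G.weight _ _ h + p.length := rfl
    have hik : i ≠ k := fun e => G.loopless k (e ▸ h)
    -- Positivity of lengths puts both the first edge and the remaining path within `t`.
    have htri : triangle K i k j ∈ pathChains K (dFl (G.SP t)) 2 :=
      triangle_mem K (.inr ⟨hik, .single h, by change G.weight _ _ h ≤ t; linarith⟩)
        (.inr ⟨hkj, p, by linarith⟩) (.inr ⟨hij, .cons h p, hp⟩) fun e => absurd e hij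
    have h1 := ht _ htri
    rw [bd_triangle, map_add, map_sub] at h1
    convert sub_mem (add_mem (hG _ _ h) (ih (by linarith) hkj)) h1 using 1
    abel

/-- On homology `gf` induces the structure map, at the level of cycles. -/
theorem push_sub_mem_boundaries {δ : ℝ≥0} {f : V → W} {g : W → V}
    (hcf : G.IsPathCollapsing f) (hcg : H.IsPathCollapsing g)
    (hsf : IsShifting G H δ f) (hsg : IsShifting H G δ g)
    (hcod : GroundedCodistortionLE G g f δ) (t : ℝ≥0) {c : Lam K V 1}
    (hc : c ∈ groundedChains K G t 1) (hz : bd K V 0 c = 0) :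
    push K g 1 (push K f 1 c) - c ∈ (groundedChains K G (t + δ + δ) 2).map (bd K V 1) := by
  obtain ⟨hid, hgf, hom⟩ := hcod
  obtain ⟨L, hL, hLe⟩ := hom.exists_correction K
  have hS : triangleBoundaries K (G.SP (2 * δ)) ≤
      (groundedChains K G (t + δ + δ) 2).map (bd K V 1) := by
    refine (triangleBoundaries_mono K (G.SP_mono ?_)).trans
      (Submodule.map_mono (Omega_dFl K (G.SP ↑(t + δ + δ)) 2).ge)
    push_cast
    linarith [t.coe_nonneg]
  have hG : ∀ x y, G.Adj x y → defect K (g ∘ f) L (edge K x y) ∈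
      (groundedChains K G (t + δ + δ) 2).map (bd K V 1) := by
    intro x y hxy
    rw [defect_edge]
    -- An edge fixed by `g ∘ f` has both ends in `V_fix`, where `L` vanishes, so its defect is zero;
    -- any other edge lies in `G_diff`.
    by_cases hfix : (g (f x), g (f y)) = (x, y)
    · obtain ⟨hx, hy⟩ := Prod.mk.inj hfix
      simp [hL x hx, hL y hy, hx, hy]
    · exact hS (hLe x y ⟨hxy, hfix⟩)
  have ht : ∀ c ∈ pathChains K (dFl (G.SP t)) 2, defect K (g ∘ f) L (bd K V 1 c) ∈
      (groundedChains K G (t + δ + δ) 2).map (bd K V 1) := by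
    intro c hc
    have hc' : c ∈ groundedChains K G t 2 := (Omega_dFl K (G.SP t) 2).ge hc
    rw [defect_bd, ← push_comp, ← map_sub]
    refine Submodule.mem_map_of_mem (sub_mem ?_ ?_)
    · exact push_mem_groundedChains K hcg hsg _ 2 _ (push_mem_groundedChains K hcf hsf t 2 c hc')
    · exact groundedChains_mono K G (le_self_add.trans le_self_add) 2 hc'
  have hall : pathChains K (dFl (G.unionSP t)) 1 ≤
      ((groundedChains K G (t + δ + δ) 2).map (bd K V 1)).comap (defect K (g ∘ f) L) := by
    rw [pathChains_le_iff]
    intro p hp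
    rw [Submodule.mem_comap, single_eq_edge K hp]
    have h01 : (0 : Fin 2) < 1 := by decide
    rcases hp.2 0 1 h01 with h | ⟨hne, q, hq⟩
    · exact hG _ _ h
    · exact defect_edge_of_path K hG ht q hq hne
  -- As `∂c = 0`, the defect of `c` is `(g ∘ f)_* c - c`.
  have := hall ((Omega_dFl K (G.unionSP t) 1).le hc)
  simpa [defect, hz, ← push_comp] using this

end Grounded

/-- Chain maps which agree on cycles up to boundaries induce the same map on homology. -/
theorem homologyMap_eq_of_forall_cycle {K : Type*} [Ring K]
    {C D : ChainComplex (ModuleCat K) ℕ} (a b : C ⟶ D) (n : ℕ)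
    (h : ∀ z : C.X (n + 1), C.d (n + 1) n z = 0 →
      ∃ w : D.X (n + 2), D.d (n + 2) (n + 1) w = a.f (n + 1) z - b.f (n + 1) z) :
    HomologicalComplex.homologyMap a (n + 1) = HomologicalComplex.homologyMap b (n + 1) := by
  -- Cycles surject onto homology and embed in chains, so the comparison reduces to the identity of
  -- chains in `h`.
  rw [← cancel_epi (C.homologyπ (n + 1)), HomologicalComplex.homologyπ_naturality,
    HomologicalComplex.homologyπ_naturality]
  ext z
  obtain ⟨w, hw⟩ := h (C.iCycles (n + 1) z) (by
    rw [← ModuleCat.comp_apply, HomologicalComplex.iCycles_d]; rfl)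
  have hcyc : D.toCycles (n + 2) (n + 1) w =
      HomologicalComplex.cyclesMap a (n + 1) z - HomologicalComplex.cyclesMap b (n + 1) z := by
    apply (ModuleCat.mono_iff_injective (D.iCycles (n + 1))).1 inferInstance
    rw [map_sub, ← ModuleCat.comp_apply, ← ModuleCat.comp_apply, ← ModuleCat.comp_apply,
      HomologicalComplex.toCycles_i, HomologicalComplex.cyclesMap_i,
      HomologicalComplex.cyclesMap_i, hw]
    rfl
  have h0 : D.homologyπ (n + 1) (D.toCycles (n + 2) (n + 1) w) = 0 := by
    rw [← ModuleCat.comp_apply, HomologicalComplex.toCycles_comp_homologyπ]; rfl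
  rw [hcyc, map_sub, sub_eq_zero] at h0
  exact h0

/-! ### The interleaving identities on homology -/

section Grounded

variable (K : Type v) [Field K] {G : WDigraph V} {H : WDigraph W}

theorem groundedHomologyPush_comp {δ : ℝ≥0} {f : V → W} {g : W → V}
    (hcf : G.IsPathCollapsing f) (hcg : H.IsPathCollapsing g)
    (hsf : IsShifting G H δ f) (hsg : IsShifting H G δ g)
    (hcod : GroundedCodistortionLE G g f δ) (t : ℝ≥0) :
    (groundedHomologyPush K hcf hsf).app t ≫ (groundedHomologyPush K hcg hsg).app (t + δ) =
      (groundedHomology K G).map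
        (homOfLE (le_self_add.trans le_self_add : t ≤ t + δ + δ)) := by
  change HomologicalComplex.homologyMap (groundedPush K hcf hsf t) 1 ≫
    HomologicalComplex.homologyMap (groundedPush K hcg hsg (t + δ)) 1 =
    HomologicalComplex.homologyMap (groundedInclusion K G (le_self_add.trans le_self_add)) 1
  rw [← HomologicalComplex.homologyMap_comp]
  refine homologyMap_eq_of_forall_cycle _ _ 0 fun z hz => ?_
  have hd (s : ℝ≥0) (k : ℕ) : (groundedComplex K G s).d (k + 1) k =
      ModuleCat.ofHom (groundedBd K G s k) := by
    simp only [groundedComplex, ChainComplex.of_d]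
  rw [hd] at hz
  rw [hd]
  have hz' : bd K V 0 z.1 = 0 := congrArg Subtype.val hz
  obtain ⟨w, hw, hwz⟩ := push_sub_mem_boundaries K hcf hcg hsf hsg hcod t z.2 hz'
  exact ⟨⟨w, hw⟩, Subtype.ext hwz⟩

end Grounded

end WDigraph

end GroundedFlag

end

theorem mainTheorem12 {K : Type v} [Field K] {V W : Type u}
    (G : GroundedFlag.WDigraph V) (H : GroundedFlag.WDigraph W) (δ : ℝ≥0)
    (h : ∃ (f : V → W) (g : W → V), GroundedFlag.WDigraph.IsGroundedInterleaving G H δ f g) :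
    GroundedFlag.interleavingDist (GroundedFlag.WDigraph.groundedHomology K G)
      (GroundedFlag.WDigraph.groundedHomology K H) ≤ (δ : ℝ≥0∞) := by
  obtain ⟨f, g, h⟩ := h
  exact iInf₂_le δ ⟨GroundedFlag.WDigraph.groundedHomologyPush K h.1 h.3,
    GroundedFlag.WDigraph.groundedHomologyPush K h.2 h.4,
    GroundedFlag.WDigraph.groundedHomologyPush_comp K h.1 h.2 h.3 h.4 h.5,
    GroundedFlag.WDigraph.groundedHomologyPush_comp K h.2 h.1 h.4 h.3 h.6⟩
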